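/- Let $k \ge 3$ be an integer and let $S_k$ be the star with $k$ infinite rays: its vertices are a core $v_0$ and the vertices $v_{j,n}$ for $1 \le j \le k$ and $n \ge 1$, and its edges are $\{v_{j,n}, v_{j,n+1}\}$ for $1 \le j \le k$ and $n \ge 0$, where $v_{j,0} := v_0$ for all $j$. Let $V_k$ be its vertex set, and let $A$ be the adjacency operator of $S_k$, i.e., the bounded self-adjoint operator on the complex Hilbert space $\ell^2(V_k)$ defined by $(A\xi)(v) = \sum_{w \sim v} \xi(w)$, where the sum is over the neighbors $w$ of $v$. For $\xi \in \ell^2(V_k)$, let $\mu_\xi$ be the local spectral measure of $A$ at $\xi$, i.e., the positive Borel measure on the spectrum $\Sigma(A) \subset \mathbf R$ such that $\int_{\Sigma(A)} f \, d\mu_\xi = \langle f(A)\xi \mid \xi\rangle$ for every continuous function $f$ on $\Sigma(A)$. For a vertex $v$, let $\delta_v \in \ell^2(V_k)$ be the characteristic function of $\{v\}$. The vertex $v$ is called dominant if $\mu_\eta$ is absolutely continuous with respect to $\mu_{\delta_v}$ for all $\eta \in \ell^2(V_k)$, and cyclic if the closed linear span of $\{A^n \delta_v : n \in \mathbf N\}$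 is $\ell^2(V_k)$. Then every vertex of $S_k$ other than the core $v_0$ is dominant, and no vertex of $S_k$ (the core included) is cyclic. -/

import Mathlib

open scoped ENNReal

noncomputable section

/-! ### Local spectral measures, dominant vectors and cyclic vectors -/

section Spectral

variable {H : Type*} [NormedAddCommGroup H] [InnerProductSpace ℂ H] [CompleteSpace H]

/-- The positive linear functional `f ↦ ⟨f(X) ξ | ξ⟩` on the real continuous functions on the
(compact, real) spectrum of a bounded self-adjoint operator `X`, where `f(X)` is the continuous
functional calculus. -/
def localSpectralFunctional (X : H →L[ℂ] H) (hX : IsSelfAdjoint X) (ξ : H) :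
    CompactlySupportedContinuousMap (spectrum ℝ X) ℝ →ₚ[ℝ] ℝ :=
  PositiveLinearMap.mk₀
    { toFun := fun f => (inner ℂ ξ (cfcHom hX (f : C(spectrum ℝ X, ℝ)) ξ)).re
      map_add' := fun f g => by
        have h : ((f + g : CompactlySupportedContinuousMap (spectrum ℝ X) ℝ) :
            C(spectrum ℝ X, ℝ)) = (f : C(spectrum ℝ X, ℝ)) + g := rfl
        rw [h, map_add, _root_.add_apply, inner_add_right, Complex.add_re]
      map_smul' := fun c f => by
        have h : ((c • f : CompactlySupportedContinuousMap (spectrum ℝ X) ℝ) :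
            C(spectrum ℝ X, ℝ)) = c • (f : C(spectrum ℝ X, ℝ)) := rfl
        rw [h, map_smul, _root_.smul_apply, inner_smul_right_eq_smul,
          Complex.real_smul, Complex.re_ofReal_mul]
        rfl }
    (fun f hf => by
      have h : 0 ≤ cfcHom hX (f : C(spectrum ℝ X, ℝ)) :=
        (cfcHom_nonneg_iff hX).2 fun x => hf x
      exact ((ContinuousLinearMap.nonneg_iff_isPositive _).1 h).re_inner_nonneg_right ξ)

/-- The local spectral measure `μ_ξ` of a bounded self-adjoint operator `X` at a vector `ξ`:
the positive Borel measure on the spectrum of `X` representing `f ↦ ⟨f(X) ξ | ξ⟩`. -/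
def localSpectralMeasure (X : H →L[ℂ] H) (hX : IsSelfAdjoint X) (ξ : H) :
    MeasureTheory.Measure (spectrum ℝ X) :=
  RealRMK.rieszMeasure (localSpectralFunctional X hX ξ)

/-- The defining property `∫ f dμ_ξ = ⟨f(X) ξ | ξ⟩` of the local spectral measure. -/
theorem integral_localSpectralMeasure (X : H →L[ℂ] H) (hX : IsSelfAdjoint X) (ξ : H)
    (f : C(spectrum ℝ X, ℝ)) :
    ∫ t, f t ∂(localSpectralMeasure X hX ξ) = (inner ℂ (cfcHom hX f ξ) ξ).re := by
  have h := RealRMK.integral_rieszMeasure (localSpectralFunctional X hX ξ)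
    (CompactlySupportedContinuousMap.continuousMapEquiv f)
  have h2 : localSpectralFunctional X hX ξ
      (CompactlySupportedContinuousMap.continuousMapEquiv f)
        = (inner ℂ ξ (cfcHom hX f ξ)).re := rfl
  rw [h2, ← Complex.conj_re, inner_conj_symm] at h
  exact h

/-- A vector `ξ` is dominant for `X` if `μ_η ≪ μ_ξ` for all vectors `η`. -/
def IsDominantVector (X : H →L[ℂ] H) (hX : IsSelfAdjoint X) (ξ : H) : Prop :=
  ∀ η : H, MeasureTheory.Measure.AbsolutelyContinuous
    (localSpectralMeasure X hX η) (localSpectralMeasure X hX ξ)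

/-- A vector `ξ` is cyclic for `X` if the closed linear span of `{X ^ n ξ : n ∈ ℕ}` is the whole
space. -/
def IsCyclicVector (X : H →L[ℂ] H) (ξ : H) : Prop :=
  (Submodule.span ℂ (Set.range fun n : ℕ => (X ^ n) ξ)).topologicalClosure = ⊤

end Spectral

/-! ### Adjacency operators of graphs of bounded degree, dominant and cyclic vertices -/

section Graph

variable {V : Type*}

/-- The complex Hilbert space `ℓ²(V)`. -/
abbrev EllTwo (V : Type*) : Type _ := lp (fun _ : V => ℂ) 2

open Classical in
/-- The canonical basis vector `δ_v` of `ℓ²(V)`. -/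
def basisVector (v : V) : EllTwo V := lp.single 2 v (1 : ℂ)

/-- A locally finite graph has bounded degree if its vertex degrees are uniformly bounded. -/
def HasBoundedDegree (G : SimpleGraph V) [G.LocallyFinite] : Prop :=
  ∃ d : ℕ, ∀ v, G.degree v ≤ d

theorem adjacency_finset_sum_le (G : SimpleGraph V) [G.LocallyFinite] {d : ℕ}
    (hd : ∀ v, G.degree v ≤ d) (ξ : EllTwo V) (s : Finset V) :
    ∑ v ∈ s, ‖∑ w ∈ G.neighborFinset v, ξ w‖ ^ 2 ≤ ((d : ℝ) * ‖ξ‖) ^ 2 := by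
  classical
  have h1 : ∀ v ∈ s, ‖∑ w ∈ G.neighborFinset v, ξ w‖ ^ 2
      ≤ (d : ℝ) * ∑ w ∈ G.neighborFinset v, ‖ξ w‖ ^ 2 := by
    intro v _
    calc ‖∑ w ∈ G.neighborFinset v, ξ w‖ ^ 2
        ≤ (∑ w ∈ G.neighborFinset v, ‖ξ w‖) ^ 2 := by
          gcongr; exact norm_sum_le _ _
      _ ≤ ((G.neighborFinset v).card : ℝ) * ∑ w ∈ G.neighborFinset v, ‖ξ w‖ ^ 2 :=
          sq_sum_le_card_mul_sum_sq
      _ ≤ _ := by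
          gcongr
          exact_mod_cast hd v
  have h2 : ∑ v ∈ s, ∑ w ∈ G.neighborFinset v, ‖ξ w‖ ^ 2
      = ∑ w ∈ s.biUnion (fun v => G.neighborFinset v),
          ∑ v ∈ s.filter (fun v => G.Adj v w), ‖ξ w‖ ^ 2 := by
    apply Finset.sum_comm'
    intro v w
    simp only [SimpleGraph.mem_neighborFinset, Finset.mem_filter, Finset.mem_biUnion]
    exact ⟨fun h => ⟨h, v, h⟩, fun h => h.1⟩
  have h3 : ∀ w, ∑ v ∈ s.filter (fun v => G.Adj v w), ‖ξ w‖ ^ 2 ≤ (d : ℝ) * ‖ξ w‖ ^ 2 := by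
    intro w
    rw [Finset.sum_const, nsmul_eq_mul]
    gcongr
    refine le_trans (Finset.card_le_card ?_) (hd w)
    intro v hv
    simpa [SimpleGraph.mem_neighborFinset] using (Finset.mem_filter.1 hv).2.symm
  have h4 : ∑ w ∈ s.biUnion (fun v => G.neighborFinset v), ‖ξ w‖ ^ 2 ≤ ‖ξ‖ ^ 2 := by
    have := lp.sum_rpow_le_norm_rpow (p := 2) (by norm_num) ξ
      (s.biUnion (fun v => G.neighborFinset v))
    simpa using this
  calc ∑ v ∈ s, ‖∑ w ∈ G.neighborFinset v, ξ w‖ ^ 2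
      ≤ ∑ v ∈ s, (d : ℝ) * ∑ w ∈ G.neighborFinset v, ‖ξ w‖ ^ 2 := Finset.sum_le_sum h1
    _ = d * ∑ w ∈ s.biUnion (fun v => G.neighborFinset v),
          ∑ v ∈ s.filter (fun v => G.Adj v w), ‖ξ w‖ ^ 2 := by rw [← Finset.mul_sum, h2]
    _ ≤ d * ∑ w ∈ s.biUnion (fun v => G.neighborFinset v), (d : ℝ) * ‖ξ w‖ ^ 2 := by
          gcongr with w _
          exact h3 w
    _ ≤ d * (d * ‖ξ‖ ^ 2) := by
          rw [← Finset.mul_sum]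
          gcongr
    _ = _ := by ring

/-- The bounded adjacency operator `A` on `ℓ²(V)` of a graph of bounded degree:
`(A ξ)(v)` is the sum of `ξ(w)` over the neighbors `w` of `v`. -/
def adjacencyOperator (G : SimpleGraph V) [G.LocallyFinite] (hG : HasBoundedDegree G) :
    EllTwo V →L[ℂ] EllTwo V :=
  LinearMap.mkContinuousOfExistsBound
    { toFun := fun ξ => ⟨fun v => ∑ w ∈ G.neighborFinset v, ξ w, by
        obtain ⟨d, hd⟩ := hG
        refine memℓp_gen' (C := ((d : ℝ) * ‖ξ‖) ^ 2) fun s => ?_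
        simpa using adjacency_finset_sum_le G hd ξ s⟩
      map_add' := fun ξ η => by
        ext v
        exact Finset.sum_add_distrib
      map_smul' := fun c ξ => by
        ext v
        simp [Finset.mul_sum] }
    (by
      obtain ⟨d, hd⟩ := hG
      refine ⟨d, fun ξ => lp.norm_le_of_forall_sum_le (by norm_num) (by positivity) fun s => ?_⟩
      simpa using adjacency_finset_sum_le G hd ξ s)

theorem adjacencyOperator_apply (G : SimpleGraph V) [G.LocallyFinite] (hG : HasBoundedDegree G)
    (ξ : EllTwo V) (v : V) :
    adjacencyOperator G hG ξ v = ∑ w ∈ G.neighborFinset v, ξ w := rfl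

theorem inner_basisVector_left (v : V) (ξ : EllTwo V) : inner ℂ (basisVector v) ξ = ξ v := by
  classical
  simp [basisVector, lp.inner_single_left]

theorem adjacencyOperator_basisVector (G : SimpleGraph V) [G.LocallyFinite]
    (hG : HasBoundedDegree G) (v : V) :
    adjacencyOperator G hG (basisVector v) = ∑ w ∈ G.neighborFinset v, basisVector w := by
  classical
  ext u
  rw [adjacencyOperator_apply, lp.coeFn_sum, Finset.sum_apply]
  simp [basisVector, lp.single_apply, Pi.single_apply, G.adj_comm]

theorem adjacencyOperator_isSelfAdjoint (G : SimpleGraph V) [G.LocallyFinite]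
    (hG : HasBoundedDegree G) : IsSelfAdjoint (adjacencyOperator G hG) := by
  rw [ContinuousLinearMap.isSelfAdjoint_iff']
  ext ξ v
  rw [← inner_basisVector_left, ContinuousLinearMap.adjoint_inner_right,
    adjacencyOperator_basisVector, sum_inner, adjacencyOperator_apply]
  simp only [inner_basisVector_left]

/-- A vertex `v` is dominant if `δ_v` is dominant for the adjacency operator. -/
def IsDominantVertex (G : SimpleGraph V) [G.LocallyFinite] (hG : HasBoundedDegree G) (v : V) :
    Prop :=
  IsDominantVector (adjacencyOperator G hG) (adjacencyOperator_isSelfAdjoint G hG) (basisVector v)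

/-- A vertex `v` is cyclic if `δ_v` is cyclic for the adjacency operator. -/
def IsCyclicVertex (G : SimpleGraph V) [G.LocallyFinite] (hG : HasBoundedDegree G) (v : V) :
    Prop :=
  IsCyclicVector (adjacencyOperator G hG) (basisVector v)

end Graph

/-! ### The infinite stars -/

/-- The vertices of the star with `k` infinite rays: the core `v_0`, and the vertices `v_{j,n}`
with `n ≥ 1` on the `j`-th ray; `ray j n` is the vertex `v_{j,n+1}`. -/
inductive StarVertex (k : ℕ) : Type
  | core : StarVertex k
  | ray (j : Fin k) (n : ℕ) : StarVertex k

/-- The vertex `v_{j,n}` for `n ≥ 0`, where `v_{j,0}` is the core. -/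
def StarVertex.at {k : ℕ} (j : Fin k) : ℕ → StarVertex k
  | 0 => StarVertex.core
  | n + 1 => StarVertex.ray j n

/-- The star `S_k` with `k` infinite rays, with edges `{v_{j,n}, v_{j,n+1}}` for all rays `j` and
all `n ≥ 0`. -/
def starGraph (k : ℕ) : SimpleGraph (StarVertex k) where
  Adj a b := ∃ (j : Fin k) (n : ℕ),
    (a = StarVertex.at j n ∧ b = StarVertex.at j (n + 1)) ∨
    (b = StarVertex.at j n ∧ a = StarVertex.at j (n + 1))
  symm := ⟨fun _ _ ⟨j, n, h⟩ => ⟨j, n, h.symm⟩⟩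
  loopless := ⟨by
    rintro a ⟨j, n, h | h⟩ <;>
      · have h' := h.1.symm.trans h.2
        cases n <;> simp [StarVertex.at] at h'⟩

theorem starGraph_neighborSet_core (k : ℕ) :
    (starGraph k).neighborSet StarVertex.core = Set.range fun j : Fin k => StarVertex.ray j 0 := by
  ext b
  constructor
  · rintro ⟨j, n, h | h⟩
    · cases n
      · exact ⟨j, h.2.symm⟩
      · simp [StarVertex.at] at h
    · simp [StarVertex.at] at h
  · rintro ⟨j, rfl⟩
    exact ⟨j, 0, Or.inl ⟨rfl, rfl⟩⟩

theorem starGraph_neighborSet_ray (k : ℕ) (j : Fin k) (n : ℕ) :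
    (starGraph k).neighborSet (StarVertex.ray j n) =
      {StarVertex.at j n, StarVertex.ray j (n + 1)} := by
  ext b
  constructor
  · rintro ⟨i, m, h | h⟩
    · cases m
      · simp [StarVertex.at] at h
      · simp only [StarVertex.at, StarVertex.ray.injEq] at h
        obtain ⟨⟨rfl, rfl⟩, rfl⟩ := h
        exact Or.inr rfl
    · simp only [StarVertex.at, StarVertex.ray.injEq] at h
      obtain ⟨rfl, rfl, rfl⟩ := h
      exact Or.inl rfl
  · rintro (rfl | rfl)
    · exact ⟨j, n, Or.inr ⟨rfl, rfl⟩⟩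
    · exact ⟨j, n + 1, Or.inl ⟨rfl, rfl⟩⟩

instance starGraph_locallyFinite (k : ℕ) : (starGraph k).LocallyFinite := fun v =>
  Set.Finite.fintype (by
    cases v with
    | core => rw [starGraph_neighborSet_core]; exact Set.finite_range _
    | ray j n => rw [starGraph_neighborSet_ray]; exact Set.toFinite _)

theorem starGraph_hasBoundedDegree (k : ℕ) : HasBoundedDegree (starGraph k) := by
  refine ⟨k + 2, fun v => ?_⟩
  rw [← SimpleGraph.card_neighborSet_eq_degree, ← Nat.card_eq_fintype_card,
    Nat.card_coe_set_eq]
  cases v with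
  | core =>
    rw [starGraph_neighborSet_core, ← Nat.card_coe_set_eq]
    have := Finite.card_range_le (fun j : Fin k => StarVertex.ray j 0)
    simp only [Nat.card_eq_fintype_card, Fintype.card_fin] at this ⊢
    omega
  | ray j n =>
    rw [starGraph_neighborSet_ray]
    have := Set.ncard_insert_le (StarVertex.at j n) {StarVertex.ray j (n + 1)}
    rw [Set.ncard_singleton] at this
    omega

end

/-!
A Borel set `N` of the spectrum is null for all local spectral measures as soon as it is null for
`μ_{δ_v}`, when `v` is not the core. The vectors `ξ` with `μ_ξ(N) = 0` form a closed subspace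
(`spectralNullSubspace`) that is stable under every operator commuting with the adjacency
operator `A`: writing a nonnegative `f` as `g²`, one has `∫ f dμ_ξ = ‖g(A) ξ‖²`, so that `μ_{ξ+η}`
is at most `2 (μ_ξ + μ_η)`, and `μ_{Tξ}` at most `‖T‖² μ_ξ` if `T` commutes with `A`.
If `N` is null for one vertex at distance `n + 1` from the core, it is thus null for all of them,
since permutations of the rays commute with `A`.

The orthogonal complement `M` of that subspace is then `A`-invariant and consists of functions
vanishing at distance `n + 1` from the core. Looking at `ξ` and `A ξ` at that distance, one sees
inductively that a function in `M` is determined by its values on the ball of radius `n + 1`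
(`eq_zero_of_mem_of_ball_eq_zero`), so `M` is finite-dimensional. If it were nonzero, it would
contain an eigenvector; on each ray, this satisfies a three-term recurrence, vanishes at one point
and tends to `0`, which forces it to be zero (`eq_zero_of_starOperator_eq_smul`). Hence `M = 0`.

No vertex is cyclic because, with at least three rays, every vertex is fixed by the exchange of
two rays: the cyclic subspace it generates consists of functions invariant under this exchange
(`not_isCyclicVertex_of_starAut_swap_eq`).
-/

open MeasureTheory Filter Topology

/-! ### Comparison of local spectral measures -/

/-- Finite Borel measures are compared by integrals of nonnegative continuous functions. -/
theorem MeasureTheory.Measure.le_of_forall_integral_continuousMap_le {Ω : Type*}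
    [PseudoEMetricSpace Ω] [MeasurableSpace Ω] [BorelSpace Ω] {μ ν : Measure Ω}
    [IsFiniteMeasure μ] [IsFiniteMeasure ν]
    (h : ∀ f : C(Ω, ℝ), (∀ x, 0 ≤ f x) → ∫ x, f x ∂μ ≤ ∫ x, f x ∂ν) : μ ≤ ν := by
  have hclosed : ∀ F : Set Ω, IsClosed F → μ F ≤ ν F := by
    intro F hF
    have hpos : ∀ n : ℕ, (0 : ℝ) < 1 / ((n : ℝ) + 1) := fun n => Nat.one_div_pos_of_nat
    have hlim : Tendsto (fun n : ℕ => 1 / ((n : ℝ) + 1)) atTop (𝓝 0) :=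
      tendsto_one_div_add_atTop_nhds_zero_nat
    have h1 := tendsto_integral_thickenedIndicator_of_isClosed μ hF hpos hlim
    have h2 := tendsto_integral_thickenedIndicator_of_isClosed ν hF hpos hlim
    have h3 : μ.real F ≤ ν.real F := le_of_tendsto_of_tendsto' h1 h2 fun n =>
      h ⟨fun x => (thickenedIndicator (hpos n) F x : ℝ), by fun_prop⟩ fun x => NNReal.coe_nonneg _
    exact (ENNReal.toReal_le_toReal (measure_ne_top _ _) (measure_ne_top _ _)).1 h3
  refine Measure.le_iff.2 fun B hB => le_of_forall_lt fun r hr => ?_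
  obtain ⟨F, hFB, hF, hrF⟩ := hB.exists_lt_isClosed_of_ne_top (measure_ne_top μ B) hr
  exact hrF.trans_le ((hclosed F hF).trans (measure_mono hFB))

section Spectral

variable {H : Type*} [NormedAddCommGroup H] [InnerProductSpace ℂ H] [CompleteSpace H]
  (X : H →L[ℂ] H) (hX : IsSelfAdjoint X)

instance localSpectralMeasure_isFiniteMeasure (ξ : H) :
    IsFiniteMeasure (localSpectralMeasure X hX ξ) := by
  unfold localSpectralMeasure
  refine ⟨?_⟩
  exact isCompact_univ.measure_lt_top

/-- Writing a nonnegative function as a square `f = g²` turns `⟨f(X) ξ | ξ⟩` into a squared norm. -/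
theorem exists_integral_localSpectralMeasure_eq_norm_sq {f : C(spectrum ℝ X, ℝ)}
    (hf : ∀ t, 0 ≤ f t) : ∃ g : C(spectrum ℝ X, ℝ), ∀ ξ : H,
      ∫ t, f t ∂(localSpectralMeasure X hX ξ) = ‖cfcHom hX g ξ‖ ^ 2 := by
  let g : C(spectrum ℝ X, ℝ) := ⟨fun t => √(f t), by fun_prop⟩
  refine ⟨g, fun ξ => ?_⟩
  have hfg : f = g * g := by
    ext t
    exact (Real.mul_self_sqrt (hf t)).symm
  have hg : IsSelfAdjoint (cfcHom hX g) := (IsSelfAdjoint.all g).map (cfcHom hX)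
  have hsymm := (ContinuousLinearMap.isSelfAdjoint_iff_isSymmetric.1 hg)
  rw [integral_localSpectralMeasure, hfg, map_mul, mul_apply_eq_comp]
  have := hsymm (cfcHom hX g ξ) ξ
  simp only [ContinuousLinearMap.coe_coe] at this
  rw [this, inner_self_eq_norm_sq_to_K]
  norm_cast

/-- The total mass of `μ_ξ` is `‖ξ‖²`. -/
theorem localSpectralMeasure_univ (ξ : H) :
    localSpectralMeasure X hX ξ Set.univ = ENNReal.ofReal (‖ξ‖ ^ 2) := by
  have h := integral_localSpectralMeasure X hX ξ 1
  rw [map_one, one_apply_eq_self, inner_self_eq_norm_sq_to_K] at h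
  have h2 : (localSpectralMeasure X hX ξ).real Set.univ = ‖ξ‖ ^ 2 := by
    simpa [← Complex.ofReal_pow] using h
  rw [← h2, ofReal_measureReal]

theorem localSpectralMeasure_add_le (ξ η : H) :
    localSpectralMeasure X hX (ξ + η) ≤
      (2 : NNReal) • (localSpectralMeasure X hX ξ + localSpectralMeasure X hX η) := by
  refine Measure.le_of_forall_integral_continuousMap_le fun f hf => ?_
  have hint : ∀ ζ : H, Integrable f (localSpectralMeasure X hX ζ) := fun ζ =>
    f.continuous.integrable_of_hasCompactSupport (HasCompactSupport.of_compactSpace f)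
  obtain ⟨g, hg⟩ := exists_integral_localSpectralMeasure_eq_norm_sq X hX hf
  rw [integral_smul_nnreal_measure, integral_add_measure (hint _) (hint _), hg, hg, hg, map_add,
    NNReal.smul_def, NNReal.coe_ofNat, smul_eq_mul]
  calc ‖cfcHom hX g ξ + cfcHom hX g η‖ ^ 2 ≤ (‖cfcHom hX g ξ‖ + ‖cfcHom hX g η‖) ^ 2 := by
        gcongr
        exact norm_add_le _ _
    _ ≤ 2 * (‖cfcHom hX g ξ‖ ^ 2 + ‖cfcHom hX g η‖ ^ 2) := add_sq_le

/-- An operator commuting with `X` decreases local spectral measures up to a constant factor. -/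
theorem localSpectralMeasure_apply_le {T : H →L[ℂ] H} (hT : Commute X T) (ξ : H) :
    localSpectralMeasure X hX (T ξ) ≤ (‖T‖₊ ^ 2) • localSpectralMeasure X hX ξ := by
  refine Measure.le_of_forall_integral_continuousMap_le fun f hf => ?_
  obtain ⟨g, hg⟩ := exists_integral_localSpectralMeasure_eq_norm_sq X hX hf
  have hcomm : cfcHom hX g (T ξ) = T (cfcHom hX g ξ) :=
    DFunLike.congr_fun (hT.cfcHom hX (hX.star_eq.symm ▸ hT) g).eq ξ
  rw [integral_smul_nnreal_measure, hg, hg, hcomm, NNReal.smul_def, smul_eq_mul]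
  push_cast
  rw [← mul_pow]
  gcongr
  exact T.le_opNorm _

/-- The vectors whose local spectral measure does not charge `N`; this is the kernel of the
spectral projection of `X` on `N`. -/
def spectralNullSubspace (N : Set (spectrum ℝ X)) : Submodule ℂ H where
  carrier := {ξ | localSpectralMeasure X hX ξ N = 0}
  add_mem' {ξ η} hξ hη := by
    refine le_antisymm ((localSpectralMeasure_add_le X hX ξ η N).trans_eq ?_) zero_le
    simp only [Set.mem_ofPred_eq] at hξ hη
    simp [hξ, hη]
  zero_mem' := by
    refine measure_mono_null (Set.subset_univ N) ?_
    rw [localSpectralMeasure_univ]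
    simp
  smul_mem' c ξ hξ := by
    have hc : Commute X (c • (1 : H →L[ℂ] H)) := (Commute.one_right X).smul_right c
    refine le_antisymm ((localSpectralMeasure_apply_le X hX hc ξ N).trans_eq ?_) zero_le
    simp only [Set.mem_ofPred_eq] at hξ
    simp [hξ]

theorem mem_spectralNullSubspace {N : Set (spectrum ℝ X)} {ξ : H} :
    ξ ∈ spectralNullSubspace X hX N ↔ localSpectralMeasure X hX ξ N = 0 := Iff.rfl

theorem apply_mem_spectralNullSubspace {T : H →L[ℂ] H} (hT : Commute X T)
    {N : Set (spectrum ℝ X)} {ξ : H} (hξ : ξ ∈ spectralNullSubspace X hX N) :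
    T ξ ∈ spectralNullSubspace X hX N := by
  rw [mem_spectralNullSubspace] at hξ ⊢
  refine le_antisymm ((localSpectralMeasure_apply_le X hX hT ξ N).trans_eq ?_) zero_le
  simp [hξ]

theorem isClosed_spectralNullSubspace (N : Set (spectrum ℝ X)) :
    IsClosed (spectralNullSubspace X hX N : Set H) := by
  refine isClosed_of_closure_subset fun ξ hξ => ?_
  have hbound : ∀ η ∈ spectralNullSubspace X hX N,
      localSpectralMeasure X hX ξ N ≤ ENNReal.ofReal (2 * ‖ξ - η‖ ^ 2) := by
    intro η hη
    have h := localSpectralMeasure_add_le X hX η (ξ - η) N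
    rw [add_sub_cancel] at h
    refine h.trans ?_
    have h2 : localSpectralMeasure X hX (ξ - η) N ≤ ENNReal.ofReal (‖ξ - η‖ ^ 2) :=
      (measure_mono (Set.subset_univ N)).trans_eq (localSpectralMeasure_univ X hX _)
    rw [mem_spectralNullSubspace] at hη
    rw [ENNReal.ofReal_mul (by norm_num), Measure.smul_apply, Measure.add_apply, hη, zero_add]
    simpa [ENNReal.smul_def] using mul_le_mul_right h2 2
  obtain ⟨u, hu, hlim⟩ := mem_closure_iff_seq_limit.1 hξ
  have hlim' : Tendsto (fun n => ENNReal.ofReal (2 * ‖ξ - u n‖ ^ 2)) atTop (𝓝 0) := by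
    have h1 : Tendsto (fun n => 2 * ‖ξ - u n‖ ^ 2) atTop (𝓝 (2 * ‖ξ - ξ‖ ^ 2)) :=
      (((tendsto_const_nhds.sub hlim).norm).pow 2).const_mul 2
    simpa using ENNReal.tendsto_ofReal h1
  exact le_antisymm (ge_of_tendsto' hlim' fun n => hbound _ (hu n)) zero_le

end Spectral

/-! ### Graph automorphisms acting on the space of square-summable functions -/

section Graph

variable {V : Type*}

/-- The operator `ξ ↦ ξ ∘ e` of `ℓ²(V)`, for a permutation `e` of `V`. -/
noncomputable def permOperator (e : Equiv.Perm V) : EllTwo V →L[ℂ] EllTwo V :=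
  LinearMap.mkContinuousOfExistsBound
    { toFun := fun ξ => ⟨fun v => ξ (e v), by
        have h := (memℓp_gen_iff (by norm_num)).1 (lp.memℓp ξ)
        exact memℓp_gen (e.summable_iff.2 h)⟩
      map_add' := fun _ _ => rfl
      map_smul' := fun _ _ => rfl }
    ⟨1, fun ξ => lp.norm_le_of_forall_sum_le (by norm_num) (by positivity) fun s => by
      rw [one_mul]
      have h := lp.sum_rpow_le_norm_rpow (p := 2) (by norm_num) ξ (s.map e.toEmbedding)
      rw [Finset.sum_map] at h
      exact h⟩

theorem permOperator_apply (e : Equiv.Perm V) (ξ : EllTwo V) (v : V) :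
    permOperator e ξ v = ξ (e v) := rfl

theorem permOperator_basisVector (e : Equiv.Perm V) (v : V) :
    permOperator e (basisVector (e v)) = basisVector v := by
  classical
  ext u
  rw [permOperator_apply]
  simp [basisVector, lp.single_apply, Pi.single_apply]

theorem commute_adjacencyOperator_permOperator (G : SimpleGraph V) [G.LocallyFinite]
    (hG : HasBoundedDegree G) (e : G ≃g G) :
    Commute (adjacencyOperator G hG) (permOperator e.toEquiv) := by
  refine ContinuousLinearMap.ext fun ξ => ?_
  ext v
  rw [mul_apply_eq_comp, mul_apply_eq_comp, permOperator_apply,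
    adjacencyOperator_apply, adjacencyOperator_apply]
  refine Finset.sum_equiv e.toEquiv (fun w => ?_) fun w _ => rfl
  simp only [SimpleGraph.mem_neighborFinset]
  exact e.map_adj_iff.symm

end Graph

/-! ### The adjacency operator of the star -/

section Star

variable {k : ℕ}

/-- A permutation of the rays, as an automorphism of the star. -/
def starAut (σ : Equiv.Perm (Fin k)) : starGraph k ≃g starGraph k where
  toFun
    | StarVertex.core => StarVertex.core
    | StarVertex.ray j n => StarVertex.ray (σ j) n
  invFun
    | StarVertex.core => StarVertex.core
    | StarVertex.ray j n => StarVertex.ray (σ.symm j) n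
  left_inv v := by cases v <;> simp
  right_inv v := by cases v <;> simp
  map_rel_iff' {a b} := by
    constructor
    · rintro ⟨j, n, h⟩
      refine ⟨σ.symm j, n, ?_⟩
      rcases a with _ | ⟨i, m⟩ <;> rcases b with _ | ⟨i', m'⟩ <;> rcases n with _ | n <;>
        simp_all [StarVertex.at, Equiv.eq_symm_apply]
    · rintro ⟨j, n, h⟩
      refine ⟨σ j, n, ?_⟩
      rcases a with _ | ⟨i, m⟩ <;> rcases b with _ | ⟨i', m'⟩ <;> rcases n with _ | n <;>
        simp_all [StarVertex.at]

theorem starAut_core (σ : Equiv.Perm (Fin k)) :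
    starAut σ StarVertex.core = StarVertex.core := rfl

theorem starAut_ray (σ : Equiv.Perm (Fin k)) (j : Fin k) (n : ℕ) :
    starAut σ (StarVertex.ray j n) = StarVertex.ray (σ j) n := rfl

/-- The adjacency operator of the star. -/
noncomputable abbrev starOperator (k : ℕ) : EllTwo (StarVertex k) →L[ℂ] EllTwo (StarVertex k) :=
  adjacencyOperator (starGraph k) (starGraph_hasBoundedDegree k)

theorem starOperator_apply_core (ξ : EllTwo (StarVertex k)) :
    starOperator k ξ StarVertex.core = ∑ j : Fin k, ξ (StarVertex.ray j 0) := by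
  classical
  have h : (starGraph k).neighborFinset StarVertex.core =
      Finset.univ.image fun j : Fin k => StarVertex.ray j 0 := by
    ext w
    rw [SimpleGraph.mem_neighborFinset, ← SimpleGraph.mem_neighborSet,
      starGraph_neighborSet_core]
    simp
  rw [starOperator, adjacencyOperator_apply, h, Finset.sum_image]
  intro i _ j _ hij
  simpa using hij

theorem starOperator_apply_ray (ξ : EllTwo (StarVertex k)) (j : Fin k) (n : ℕ) :
    starOperator k ξ (StarVertex.ray j n) =
      ξ (StarVertex.at j n) + ξ (StarVertex.ray j (n + 1)) := by
  classical
  have h : (starGraph k).neighborFinset (StarVertex.ray j n) =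
      {StarVertex.at j n, StarVertex.ray j (n + 1)} := by
    ext w
    rw [SimpleGraph.mem_neighborFinset, ← SimpleGraph.mem_neighborSet,
      starGraph_neighborSet_ray]
    simp
  rw [starOperator, adjacencyOperator_apply, h, Finset.sum_pair]
  cases n with
  | zero => simp [StarVertex.at]
  | succ n =>
    simp only [StarVertex.at, ne_eq, StarVertex.ray.injEq, true_and]
    omega

theorem tendsto_ray (ξ : EllTwo (StarVertex k)) (j : Fin k) :
    Tendsto (fun n => ξ (StarVertex.ray j n)) atTop (𝓝 0) := by
  have h := (memℓp_gen_iff (by norm_num)).1 (lp.memℓp ξ)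
  have hinj : Function.Injective fun n : ℕ => StarVertex.ray j n := fun m n h => by simpa using h
  have h2 := (h.comp_injective hinj).tendsto_atTop_zero
  rw [tendsto_zero_iff_norm_tendsto_zero]
  have h3 : Tendsto (fun n => ‖ξ (StarVertex.ray j n)‖ ^ 2) atTop (𝓝 0) := by
    simpa [Function.comp_def] using h2
  simpa using h3.sqrt

/-- A solution of the free three-term recurrence that starts at `0` and tends to `0` vanishes. -/
theorem eq_zero_of_recurrence_of_tendsto_zero {f : ℕ → ℂ} {z : ℂ} (h0 : f 0 = 0)
    (hrec : ∀ n, f (n + 2) = z * f (n + 1) - f n) (hlim : Tendsto f atTop (𝓝 0)) (n : ℕ) :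
    f n = 0 := by
  -- The quadratic form `a² - z a b + b²` is a conserved quantity of the recurrence.
  have hcons : ∀ n, f n ^ 2 - z * f n * f (n + 1) + f (n + 1) ^ 2 = f 1 ^ 2 := by
    intro n
    induction n with
    | zero => simp [h0]
    | succ n ih => rw [← ih, hrec]; ring
  have hlim1 := (tendsto_add_atTop_iff_nat 1).2 hlim
  have hq := ((hlim.pow 2).sub ((hlim.const_mul z).mul hlim1)).add (hlim1.pow 2)
  simp only [hcons] at hq
  have h1 : f 1 = 0 := by
    have := tendsto_nhds_unique tendsto_const_nhds hq
    simpa using this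
  have key : ∀ n, f n = 0 ∧ f (n + 1) = 0 := by
    intro n
    induction n with
    | zero => exact ⟨h0, h1⟩
    | succ n ih => exact ⟨ih.2, by rw [hrec, ih.1, ih.2]; simp⟩
  exact (key n).1

/-- An eigenvector of the star that vanishes at distance `n + 1` from the core is zero: it
vanishes beyond that distance by square-summability, and then towards the core by the
recurrence. -/
theorem eq_zero_of_starOperator_eq_smul {n : ℕ} {z : ℂ} {ξ : EllTwo (StarVertex k)}
    (hk : 0 < k) (hξ : starOperator k ξ = z • ξ) (h0 : ∀ j, ξ (StarVertex.ray j n) = 0) :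
    ξ = 0 := by
  have hray : ∀ j m, ξ (StarVertex.at j m) + ξ (StarVertex.ray j (m + 1)) =
      z * ξ (StarVertex.ray j m) := by
    intro j m
    rw [← starOperator_apply_ray, hξ]
    rfl
  have hout : ∀ j m, ξ (StarVertex.ray j (n + m)) = 0 := by
    intro j
    refine eq_zero_of_recurrence_of_tendsto_zero (z := z) (h0 j) (fun m => ?_) ?_
    · exact eq_sub_of_add_eq' (hray j (n + m + 1))
    · exact (tendsto_ray ξ j).comp (tendsto_atTop_mono (fun m => Nat.le_add_left m n) tendsto_id)
  have hin : ∀ j, ∀ m ≤ n + 1, ξ (StarVertex.at j (n + 1 - m)) = 0 ∧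
      ξ (StarVertex.ray j (n + 1 - m)) = 0 := by
    intro j m
    induction m with
    | zero => exact fun _ => ⟨h0 j, hout j 1⟩
    | succ m ih =>
      intro hm
      obtain ⟨p, hp⟩ : ∃ p, n + 1 - m = p + 1 := ⟨n - m, by omega⟩
      have hp' : n + 1 - (m + 1) = p := by omega
      have h := ih (by omega)
      rw [hp] at h
      rw [hp']
      have h1 : ξ (StarVertex.ray j p) = 0 := h.1
      have h2 := hray j p
      rw [h1, h.2, mul_zero, add_zero] at h2
      exact ⟨h2, h1⟩
  ext v
  cases v with
  | core => simpa [StarVertex.at] using (hin ⟨0, hk⟩ (n + 1) le_rfl).1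
  | ray j m =>
    rcases le_total n m with h | h
    · obtain ⟨p, rfl⟩ := Nat.exists_eq_add_of_le h
      exact hout j p
    · have := (hin j (n + 1 - m) (by omega)).2
      rwa [show n + 1 - (n + 1 - m) = m by omega] at this

/-- In an invariant subspace of functions vanishing at distance `n + 1` from the core, a function
is determined by its values on the ball of that radius. -/
theorem eq_zero_of_mem_of_ball_eq_zero {n : ℕ} {M : Submodule ℂ (EllTwo (StarVertex k))}
    (hM : ∀ ξ ∈ M, starOperator k ξ ∈ M) (h0 : ∀ ξ ∈ M, ∀ j, ξ (StarVertex.ray j n) = 0)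
    {ξ : EllTwo (StarVertex k)} (hξ : ξ ∈ M) (hcore : ξ StarVertex.core = 0)
    (hball : ∀ j, ∀ m ≤ n, ξ (StarVertex.ray j m) = 0) : ξ = 0 := by
  have key : ∀ r, ∀ ξ ∈ M, ξ StarVertex.core = 0 →
      (∀ j, ∀ m ≤ n, ξ (StarVertex.ray j m) = 0) →
      ∀ j, ∀ m ≤ n + r, ξ (StarVertex.ray j m) = 0 := by
    intro r
    induction r with
    | zero => exact fun ξ _ _ h => h
    | succ r ih =>
      intro ξ hξ hcore hball j m hm
      have hr := ih ξ hξ hcore hball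
      rcases Nat.lt_or_ge m (n + r + 1) with hlt | hge
      · exact hr j m (by omega)
      obtain rfl : m = n + r + 1 := by omega
      have hat : ∀ i, ∀ p ≤ n + r, ξ (StarVertex.at i p) = 0 := by
        intro i p hp
        cases p with
        | zero => exact hcore
        | succ p => exact hr i p (by omega)
      -- The image of `ξ` vanishes on the ball too: at distance `n + 1` because it lies in `M`.
      have hA := ih (starOperator k ξ) (hM ξ hξ)
        (by rw [starOperator_apply_core]; exact Finset.sum_eq_zero fun i _ => hball i 0 n.zero_le)
        (by
          intro i p hp
          rcases hp.lt_or_eq with hlt | rfl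
          · rw [starOperator_apply_ray, hat i p (by omega), hball i (p + 1) hlt, add_zero]
          · exact h0 _ (hM ξ hξ) i)
        j (n + r) le_rfl
      rwa [starOperator_apply_ray, hat j _ le_rfl, zero_add] at hA
  ext v
  cases v with
  | core => exact hcore
  | ray j m => exact key m ξ hξ hcore hball j m (by omega)

/-- An invariant subspace of functions vanishing at distance `n + 1` from the core is zero: it is
finite-dimensional, hence would contain an eigenvector. -/
theorem eq_bot_of_invariant_of_vanishing {n : ℕ} (hk : 0 < k)
    {M : Submodule ℂ (EllTwo (StarVertex k))}
    (hM : ∀ ξ ∈ M, starOperator k ξ ∈ M) (h0 : ∀ ξ ∈ M, ∀ j, ξ (StarVertex.ray j n) = 0) :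
    M = ⊥ := by
  let R : M →ₗ[ℂ] ℂ × (Fin k → Fin (n + 1) → ℂ) :=
    { toFun := fun ξ => (ξ.1 StarVertex.core, fun j m => ξ.1 (StarVertex.ray j m))
      map_add' := fun _ _ => rfl
      map_smul' := fun _ _ => rfl }
  have hR : Function.Injective R := by
    refine (injective_iff_map_eq_zero R).2 fun ξ hξ => Subtype.ext ?_
    refine eq_zero_of_mem_of_ball_eq_zero hM h0 ξ.2 (congrArg Prod.fst hξ) fun j m hm => ?_
    exact congrFun (congrFun (congrArg Prod.snd hξ) j) ⟨m, by omega⟩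
  have hfin : FiniteDimensional ℂ M := Module.Finite.of_injective R hR
  by_contra hne
  have hnt : Nontrivial M := Submodule.nontrivial_iff_ne_bot.2 hne
  obtain ⟨z, hz⟩ := Module.End.exists_eigenvalue
    ((starOperator k : EllTwo (StarVertex k) →ₗ[ℂ] EllTwo (StarVertex k)).restrict hM)
  obtain ⟨ξ, hξ⟩ := hz.exists_hasEigenvector
  refine hξ.2 (Subtype.ext ?_)
  exact eq_zero_of_starOperator_eq_smul hk (congrArg Subtype.val hξ.apply_eq_smul) (h0 ξ ξ.2)

theorem isDominantVertex_ray (hk : 0 < k) (j : Fin k) (n : ℕ) :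
    IsDominantVertex (starGraph k) (starGraph_hasBoundedDegree k) (StarVertex.ray j n) := by
  intro η
  refine Measure.AbsolutelyContinuous.mk fun N _ hN => ?_
  have hA := adjacencyOperator_isSelfAdjoint (starGraph k) (starGraph_hasBoundedDegree k)
  let D := spectralNullSubspace (starOperator k) hA N
  have hD : ∀ i, basisVector (StarVertex.ray i n) ∈ D := by
    intro i
    have h := apply_mem_spectralNullSubspace (starOperator k) hA
      (commute_adjacencyOperator_permOperator (starGraph k) (starGraph_hasBoundedDegree k)
        (starAut (Equiv.swap i j))) hN
    have he : (starAut (Equiv.swap i j)).toEquiv (StarVertex.ray i n) = StarVertex.ray j n :=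
      (starAut_ray _ i n).trans (by rw [Equiv.swap_apply_left])
    rwa [← he, permOperator_basisVector] at h
  have hbot : Dᗮ = ⊥ := by
    refine eq_bot_of_invariant_of_vanishing (n := n) hk (fun ξ hξ => ?_) fun ξ hξ i => ?_
    · rw [Submodule.mem_orthogonal] at hξ ⊢
      intro ζ hζ
      have hsymm := ContinuousLinearMap.isSelfAdjoint_iff_isSymmetric.1 hA ζ ξ
      have := hξ _ (apply_mem_spectralNullSubspace (starOperator k) hA (Commute.refl _) hζ)
      exact hsymm.symm.trans this
    · rw [← inner_basisVector_left]
      exact (Submodule.mem_orthogonal _ _).1 hξ _ (hD i)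
  have hcl : IsClosed (D : Set (EllTwo (StarVertex k))) := isClosed_spectralNullSubspace _ hA N
  have : CompleteSpace D := hcl.completeSpace_coe
  have htop : D = ⊤ := Submodule.orthogonal_eq_bot_iff.1 hbot
  exact (mem_spectralNullSubspace (starOperator k) hA).1
    (htop ▸ Submodule.mem_top : η ∈ D)

/-- A vertex fixed by the exchange of two rays only generates functions that agree on both. -/
theorem not_isCyclicVertex_of_starAut_swap_eq {i i' : Fin k} (hii' : i ≠ i') {v : StarVertex k}
    (hv : starAut (Equiv.swap i i') v = v) :
    ¬ IsCyclicVertex (starGraph k) (starGraph_hasBoundedDegree k) v := by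
  intro hcyc
  let U := permOperator (starAut (Equiv.swap i i')).toEquiv
  have hU : Commute (starOperator k) U :=
    commute_adjacencyOperator_permOperator _ _ (starAut (Equiv.swap i i'))
  let K : Submodule ℂ (EllTwo (StarVertex k)) := (U - 1).ker
  have hmem : ∀ ξ, ξ ∈ K ↔ U ξ = ξ := by
    intro ξ
    rw [LinearMap.mem_ker]
    exact sub_eq_zero
  have hδ : U (basisVector v) = basisVector v := by
    have h := permOperator_basisVector (starAut (Equiv.swap i i')).toEquiv v
    rwa [show (starAut (Equiv.swap i i')).toEquiv v = v from hv] at h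
  have hle : (Submodule.span ℂ (Set.range fun n : ℕ =>
      (starOperator k ^ n) (basisVector v))).topologicalClosure ≤ K := by
    refine Submodule.topologicalClosure_minimal _ (Submodule.span_le.2 ?_) (U - 1).isClosed_ker
    rintro _ ⟨n, rfl⟩
    refine (hmem _).2 ?_
    have h := DFunLike.congr_fun (hU.pow_left n).eq (basisVector v)
    simp only [mul_apply_eq_comp, hδ] at h
    exact h.symm
  have htop : basisVector (StarVertex.ray i 0) ∈ K := hle (by
    rw [show (Submodule.span ℂ (Set.range fun n : ℕ =>
      (starOperator k ^ n) (basisVector v))).topologicalClosure = ⊤ from hcyc]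
    exact Submodule.mem_top)
  have h := congrArg (fun ξ : EllTwo (StarVertex k) => ξ (StarVertex.ray i' 0)) ((hmem _).1 htop)
  have he : (starAut (Equiv.swap i i')).toEquiv (StarVertex.ray i' 0) = StarVertex.ray i 0 :=
    (starAut_ray _ i' 0).trans (by rw [Equiv.swap_apply_right])
  simp only [U, permOperator_apply, he] at h
  simp [basisVector, lp.single_apply, hii'.symm] at h

end Star

theorem mainTheorem1 (k : ℕ) (hk : 3 ≤ k) :
    (∀ v : StarVertex k, v ≠ StarVertex.core →
      IsDominantVertex (starGraph k) (starGraph_hasBoundedDegree k) v) ∧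
    (∀ v : StarVertex k,
      ¬ IsCyclicVertex (starGraph k) (starGraph_hasBoundedDegree k) v) := by
  refine ⟨fun v hv => ?_, fun v => ?_⟩
  · cases v with
    | core => exact absurd rfl hv
    | ray j n => exact isDominantVertex_ray (by omega) j n
  · cases v with
    | core =>
      exact not_isCyclicVertex_of_starAut_swap_eq (i := ⟨0, by omega⟩) (i' := ⟨1, by omega⟩)
        (by simp) (starAut_core _)
    | ray j n =>
      -- Among three rays, two differ from the ray of `v`.
      obtain ⟨i, hi⟩ : ∃ i : Fin k, i ∉ ({j} : Finset (Fin k)) := by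
        by_contra! h
        have := Finset.card_le_card (fun x _ => h x : Finset.univ ⊆ ({j} : Finset (Fin k)))
        simp at this
        omega
      obtain ⟨i', hi'⟩ : ∃ i' : Fin k, i' ∉ ({j, i} : Finset (Fin k)) := by
        by_contra! h
        have := Finset.card_le_card (fun x _ => h x : Finset.univ ⊆ ({j, i} : Finset (Fin k)))
        have h2 := Finset.card_le_two (a := j) (b := i)
        simp only [Finset.card_univ, Fintype.card_fin] at this
        omega
      simp only [Finset.mem_singleton, Finset.mem_insert, not_or] at hi hi'
      refine not_isCyclicVertex_of_starAut_swap_eq (Ne.symm hi'.2) ?_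
      rw [starAut_ray, Equiv.swap_apply_of_ne_of_ne (Ne.symm hi) (Ne.symm hi'.1)]
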